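/- Fix an integer $d\ge 1$, real numbers $a_1,\dots,a_d>0$ and $\alpha_1,\dots,\alpha_d>1$, and put $\sigma_j=\sqrt{2\log\alpha_j/a_j}$ for $1\le j\le d$. Assume that $\sigma_1<\dots<\sigma_d$. For $n\in\mathbb N$ let $N_{n,1},\dots,N_{n,d}$ be natural numbers such that $\lim_{n\to\infty}N_{n,j}/\alpha_j^n=1$ for every $1\le j\le d$. For each $n$ let $$\{\xi_{\varepsilon_1\ldots\varepsilon_j}\colon 1\le j\le d,\ 1\le\varepsilon_1\le N_{n,1},\dots,1\le\varepsilon_j\le N_{n,j}\}$$ be independent real standard normal random variables on some probability space (which may depend on $n$), and define the partition function of the Generalized Random Energy Model by $$\mathcal Z_n(\beta)=\sum_{\varepsilon_1=1}^{N_{n,1}}\cdots\sum_{\varepsilon_d=1}^{N_{n,d}}\exp\Big(\beta\sqrt n\,\sum_{j=1}^d\sqrt{a_j}\,\xi_{\varepsilon_1\ldots\varepsilon_j}\Big),\qquad \beta\in\mathbb C .$$ Let $$G_1=\{\beta\in\mathbb C\colon 2|\operatorname{Re}\beta|>\sigma_1,\ |\operatorname{Re}\beta|+|\operatorname{Im}\beta|>\sigma_1\},\qquad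 F_1=\{\beta\in\mathbb C\colon 2|\operatorname{Re}\beta|<\sigma_1,\ 2|\beta|^2>\sigma_1^2\},$$ and let $E_1=\mathbb C\setminus\overline{G_1\cup F_1}$, where the bar denotes the closure. Let $K$ be a compact subset of $E_1$. Then there exist $C>0$ and $\varepsilon>0$, depending only on $K$ and on the parameters $d$, $(a_j)$, $(\alpha_j)$, $(N_{n,j})$ of the model, such that for all $n\in\mathbb N$ $$\mathbb P\big[\exists\,\beta\in K\colon \mathcal Z_n(\beta)=0\big]<C\,e^{-\varepsilon n}.$$ -/

import Mathlib

/-!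
Definitions for the Generalized Random Energy Model (GREM): the tree that indexes the
energies, the energies, the partition function, and the phases of a single level.
Levels are indexed by `Fin d`, so that the first level is the level `0`.
-/

namespace GREM

/-- The set of root-to-leaf paths of the tree with `N j` children at level `j`: a path is a
sequence `(ε_1, …, ε_d)` with `N j` possible values for its `j`-th entry. -/
abbrev Leaf {d : ℕ} (N : Fin d → ℕ) : Type := (i : Fin d) → Fin (N i)

/-- The edges of the tree: an edge at level `j` is labelled by the initial
segment `(ε_1, …, ε_j)`, the entry at level `j` included. -/
abbrev Edge {d : ℕ} (N : Fin d → ℕ) : Type :=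
  (j : Fin d) × ((i : {i : Fin d // i ≤ j}) → Fin (N i.1))

/-- The edge at level `j` on the path `ε`. -/
def Leaf.edge {d : ℕ} {N : Fin d → ℕ} (ε : Leaf N) (j : Fin d) : Edge N :=
  ⟨j, fun i => ε i.1⟩

/-- The energy `X_ε = √a_1 ξ_{ε_1} + √a_2 ξ_{ε_1 ε_2} + … + √a_d ξ_{ε_1 … ε_d}`. -/
noncomputable def energy {d : ℕ} {N : Fin d → ℕ} (a : Fin d → ℝ) (ξ : Edge N → ℝ)
    (ε : Leaf N) : ℝ :=
  ∑ j : Fin d, Real.sqrt (a j) * ξ (ε.edge j)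

/-- The partition function `Z_n(β) = ∑_ε exp (β √n X_ε)`, with `N` the branching
numbers of the `n`-th tree and `ξ` the values on its edges. -/
noncomputable def partitionFunction {d : ℕ} {N : Fin d → ℕ} (a : Fin d → ℝ) (n : ℕ)
    (ξ : Edge N → ℝ) (β : ℂ) : ℂ :=
  ∑ ε : Leaf N, Complex.exp (β * (Real.sqrt n : ℂ) * (energy a ξ ε : ℂ))

/-- The critical inverse temperature `√(2 log α / a)` of a level with variance `a` and
branching exponent `α`. -/
noncomputable def criticalTemp (a α : ℝ) : ℝ := Real.sqrt (2 * Real.log α / a)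

/-- The glassy phase of a level with critical inverse temperature `s`. -/
def phaseG (s : ℝ) : Set ℂ := {β | s < 2 * |β.re| ∧ s < |β.re| + |β.im|}

/-- The fluctuation dominated phase of a level with critical inverse temperature `s`. -/
def phaseF (s : ℝ) : Set ℂ := {β | 2 * |β.re| < s ∧ s ^ 2 < 2 * (β.re ^ 2 + β.im ^ 2)}

/-- The expectation dominated phase of a level with critical inverse temperature `s`:
the complement of the closure of the union of the two other phases. -/
def phaseE (s : ℝ) : Set ℂ := (closure (phaseG s ∪ phaseF s))ᶜ

end GREM

open MeasureTheory ProbabilityTheory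

/-! Divide `𝒵_n(β)` by its expectation, which never vanishes. The quotient has mean one, and at a
zero it is at distance exactly one from its mean. So it suffices that, near each point of `K`, the
quotient is exponentially close to `1` in `L^p` for some `1 < p ≤ 2`.

Telescoping along the tree writes the deviation as a sum over edges of a centered weight times a
factor depending only on earlier levels. A von Bahr–Esseen inequality (`integral_norm_sum_rpow_le`)
bounds its `p`-th moment by a sum over `j` of products over `i ≤ j` of `N_i^(1-p)` times a Gaussian
moment. Level `i` decays exponentially when `p (Re β)^2 + p/(p-1) (Im β)^2 < σ_i^2`. Every point of
`E_1` admits such a `p` for `σ_1` (`exists_exponent_of_mem_phaseE`), and `σ_1` is the smallest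
`σ_i`, so the same `p` serves all levels.

Cauchy's formula, Fubini and Markov turn the moment bound at fixed points into a bound on the
probability of a zero in a disc (`measure_exists_norm_eq_one_le`). Compactness of `K` finishes the
proof. -/

/-! ### Elementary inequalities for `p`-th powers -/

theorem le_one_add_rpow {u p : ℝ} (hu : 0 ≤ u) (hp : 1 ≤ p) : u ≤ 1 + u ^ p := by
  rcases le_total u 1 with h | h
  · have := Real.rpow_nonneg hu p
    linarith
  · have := Real.self_le_rpow_of_one_le h hp
    linarith

theorem rpow_sub_one_mul_le {u v p : ℝ} (hu : 0 ≤ u) (hv : 0 ≤ v) (hp : 1 < p) :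
    u ^ (p - 1) * v ≤ u ^ p + v ^ p := by
  have key : ∀ {t : ℝ}, 0 ≤ t → t ^ (p - 1) * t = t ^ p := fun {t} ht => by
    conv_lhs => rw [← Real.rpow_add_one' ht (by linarith)]
    congr 1; ring
  have hup := Real.rpow_nonneg hu p
  have hvp := Real.rpow_nonneg hv p
  rcases le_total u v with h | h
  · have : u ^ (p - 1) * v ≤ v ^ (p - 1) * v := by gcongr
    rw [key hv] at this; linarith
  · have : u ^ (p - 1) * v ≤ u ^ (p - 1) * u := by gcongr
    rw [key hu] at this; linarith

/-- A first order expansion of the `p`-th power of the norm with a remainder of order `p`. -/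
theorem Complex.norm_add_rpow_le {p : ℝ} (hp : 1 < p) (hp2 : p ≤ 2) (z w : ℂ) :
    ‖z + w‖ ^ p ≤ ‖z‖ ^ p + p * (‖z‖ ^ (p - 2) * (starRingEnd ℂ z * w).re) + 6 * ‖w‖ ^ p := by
  have hwp : 0 ≤ ‖w‖ ^ p := by positivity
  rcases eq_or_ne z 0 with rfl | hz
  · have h0 : (0 : ℝ) ^ p = 0 := Real.zero_rpow (by linarith)
    simp only [zero_add, norm_zero, map_zero, zero_mul, Complex.zero_re, mul_zero, add_zero, h0]
    linarith
  have hz0 : 0 < ‖z‖ := norm_pos_iff.2 hz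
  have hzp : 0 ≤ ‖z‖ ^ p := by positivity
  have hre : |(starRingEnd ℂ z * w).re| ≤ ‖z‖ * ‖w‖ := by
    refine (Complex.abs_re_le_norm _).trans ?_
    simp
  have hpow : ∀ {t : ℝ}, 0 < t → t ^ (p - 2) * t * t = t ^ p := fun {t} ht => by
    rw [← Real.rpow_add_one ht.ne', ← Real.rpow_add_one ht.ne']; congr 1; ring
  -- If `w` dominates, every term is of order `‖w‖ ^ p`, and `4 + p ≤ 6` gives the constant.
  rcases lt_or_ge ‖z‖ ‖w‖ with hlt | hge
  · have hw0 : 0 < ‖w‖ := hz0.trans hlt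
    have h1 : ‖z + w‖ ^ p ≤ 4 * ‖w‖ ^ p := by
      calc ‖z + w‖ ^ p ≤ (2 * ‖w‖) ^ p := by
            gcongr
            have := norm_add_le z w
            linarith
        _ = 2 ^ p * ‖w‖ ^ p := Real.mul_rpow (by norm_num) hw0.le
        _ ≤ 2 ^ (2 : ℝ) * ‖w‖ ^ p := by gcongr; norm_num
        _ = 4 * ‖w‖ ^ p := by norm_num
    have h2 : ‖z‖ ^ (p - 2) * (‖z‖ * ‖w‖) ≤ ‖w‖ ^ p := by
      have e1 : ‖z‖ ^ (p - 2) * ‖z‖ = ‖z‖ ^ (p - 1) := by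
        rw [← Real.rpow_add_one hz0.ne']; congr 1; ring
      have e2 : ‖w‖ ^ (p - 2) * ‖w‖ = ‖w‖ ^ (p - 1) := by
        rw [← Real.rpow_add_one hw0.ne']; congr 1; ring
      calc ‖z‖ ^ (p - 2) * (‖z‖ * ‖w‖) = ‖z‖ ^ (p - 1) * ‖w‖ := by rw [← mul_assoc, e1]
        _ ≤ ‖w‖ ^ (p - 1) * ‖w‖ := by gcongr
        _ = ‖w‖ ^ p := by rw [← e2, hpow hw0]
    have h3 : -(‖w‖ ^ p) ≤ ‖z‖ ^ (p - 2) * (starRingEnd ℂ z * w).re := by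
      have : -(‖z‖ * ‖w‖) ≤ (starRingEnd ℂ z * w).re := (abs_le.1 hre).1
      have hq : 0 ≤ ‖z‖ ^ (p - 2) := by positivity
      nlinarith [mul_le_mul_of_nonneg_left this hq]
    nlinarith [mul_le_mul_of_nonneg_left h3 (by linarith : (0 : ℝ) ≤ p)]
  · have hsq : ‖z + w‖ ^ 2 = ‖z‖ ^ 2 * (1 + (2 * (starRingEnd ℂ z * w).re + ‖w‖ ^ 2) / ‖z‖ ^ 2) := by
      rw [mul_add, mul_div_cancel₀ _ (by positivity), Complex.sq_norm, Complex.sq_norm,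
        Complex.sq_norm, Complex.normSq_add]
      have : (z * (starRingEnd ℂ) w).re = ((starRingEnd ℂ) z * w).re := by
        simp
      rw [this]; ring
    set s := (2 * (starRingEnd ℂ z * w).re + ‖w‖ ^ 2) / ‖z‖ ^ 2 with hs
    have hs1 : -1 ≤ s := by
      have : 0 ≤ ‖z‖ ^ 2 * (1 + s) := hsq ▸ by positivity
      have := nonneg_of_mul_nonneg_right this (by positivity)
      linarith
    -- Bernoulli for the concave power `p / 2`, applied to `‖z + w‖² / ‖z‖² = 1 + s`.
    have hb := rpow_one_add_le_one_add_mul_self hs1 (p := p / 2) (by linarith) (by linarith)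
    have e : ∀ t : ℝ, 0 ≤ t → (t ^ 2) ^ (p / 2) = t ^ p := fun t ht => by
      rw [← Real.rpow_natCast, ← Real.rpow_mul ht]; congr 1; push_cast; ring
    have h1 : ‖z + w‖ ^ p ≤ ‖z‖ ^ p * (1 + p / 2 * s) := by
      rw [← e _ (norm_nonneg _), hsq, Real.mul_rpow (by positivity) (by linarith), e _ hz0.le]
      gcongr
    have h2 : ‖z‖ ^ p * s = ‖z‖ ^ (p - 2) * (2 * (starRingEnd ℂ z * w).re) +
        ‖z‖ ^ (p - 2) * ‖w‖ ^ 2 := by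
      rw [hs, ← hpow hz0]; field_simp
    have h3 : ‖z‖ ^ (p - 2) * ‖w‖ ^ 2 ≤ ‖w‖ ^ p := by
      rcases eq_or_ne w 0 with rfl | hw
      · rw [norm_zero, Real.zero_rpow (by linarith)]; simp
      have hw0 : 0 < ‖w‖ := norm_pos_iff.2 hw
      have : ‖z‖ ^ (p - 2) ≤ ‖w‖ ^ (p - 2) :=
        Real.rpow_le_rpow_of_nonpos hw0 hge (by linarith)
      calc ‖z‖ ^ (p - 2) * ‖w‖ ^ 2 ≤ ‖w‖ ^ (p - 2) * ‖w‖ ^ 2 := by gcongr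
        _ = ‖w‖ ^ p := by rw [← hpow hw0]; ring
    nlinarith

/-! ### A von Bahr–Esseen inequality -/

section MartingaleDifference

variable {Ω : Type*} {mΩ : MeasurableSpace Ω} {μ : Measure Ω}

theorem integral_re_eq_re_integral {f : Ω → ℂ} (hf : Integrable f μ) :
    ∫ ω, (f ω).re ∂μ = (∫ ω, f ω ∂μ).re :=
  integral_re hf

/-- Adding to `S` the product of `A` with an independent centered factor. -/
theorem integral_norm_add_mul_rpow_le [IsProbabilityMeasure μ] {p : ℝ} (hp : 1 < p) (hp2 : p ≤ 2)
    {m₁ m₂ : MeasurableSpace Ω} (hm₁ : m₁ ≤ mΩ) (hm₂ : m₂ ≤ mΩ) (hI : Indep m₁ m₂ μ)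
    {S A W : Ω → ℂ} (hS : Measurable[m₁] S) (hA : Measurable[m₁] A) (hW : Measurable[m₂] W)
    (iS : Integrable (fun ω => ‖S ω‖ ^ p) μ) (iA : Integrable (fun ω => ‖A ω‖ ^ p) μ)
    (iW : Integrable (fun ω => ‖W ω‖ ^ p) μ) (hW0 : ∫ ω, W ω ∂μ = 0) :
    Integrable (fun ω => ‖S ω + A ω * W ω‖ ^ p) μ ∧
    ∫ ω, ‖S ω + A ω * W ω‖ ^ p ∂μ ≤
      ∫ ω, ‖S ω‖ ^ p ∂μ + 6 * ((∫ ω, ‖A ω‖ ^ p ∂μ) * ∫ ω, ‖W ω‖ ^ p ∂μ) := by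
  have hS' := hS.mono hm₁ le_rfl
  have hA' := hA.mono hm₁ le_rfl
  have hW' := hW.mono hm₂ le_rfl
  have indep : ∀ {E F : Type} [MeasurableSpace E] [MeasurableSpace F] {f : Ω → E} {g : Ω → F},
      Measurable[m₁] f → Measurable[m₂] g → IndepFun f g μ := fun hf hg => by
    rw [IndepFun_iff_Indep]
    exact indep_of_indep_of_le_left (indep_of_indep_of_le_right hI hg.comap_le) hf.comap_le
  have iW1 : Integrable W μ := by
    refine ((integrable_const (1 : ℝ)).add iW).mono' hW'.aestronglyMeasurable
      (.of_forall fun ω => ?_)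
    exact le_one_add_rpow (norm_nonneg _) hp.le
  have norm_pow : ∀ q : ℝ, Measurable fun z : ℂ => ‖z‖ ^ q := fun q => measurable_norm.pow_const q
  -- Coefficient of the first order term in the expansion around `S`. It is independent of the
  -- centered `W`, so that term integrates to zero.
  set g : Ω → ℂ := fun ω => ((‖S ω‖ ^ (p - 2) : ℝ) : ℂ) * starRingEnd ℂ (S ω) * A ω with hg
  have hgm : Measurable[m₁] g :=
    ((Complex.measurable_ofReal.comp ((norm_pow _).comp hS)).mul
      (Complex.continuous_conj.measurable.comp hS)).mul hA
  have ig : Integrable g μ := by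
    refine (iS.add iA).mono' (hgm.mono hm₁ le_rfl).aestronglyMeasurable (.of_forall fun ω => ?_)
    rcases eq_or_ne (S ω) 0 with h0 | h0
    · simp only [hg, h0, map_zero, mul_zero, zero_mul, norm_zero, Pi.add_apply]; positivity
    · have : ‖g ω‖ = ‖S ω‖ ^ (p - 1) * ‖A ω‖ := by
        simp only [hg, norm_mul, Complex.norm_real, RCLike.norm_conj]
        rw [Real.norm_of_nonneg (by positivity), ← Real.rpow_add_one (norm_ne_zero_iff.2 h0)]
        congr 2; ring
      rw [this]
      exact rpow_sub_one_mul_le (norm_nonneg _) (norm_nonneg _) hp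
  have igW : Integrable (fun ω => g ω * W ω) μ := (indep hgm hW).integrable_mul ig iW1
  have hgW : ∫ ω, g ω * W ω ∂μ = 0 := by
    rw [(indep hgm hW).integral_fun_mul_eq_mul_integral ig.1 iW1.1, hW0, mul_zero]
  have hAW : IndepFun (fun ω => ‖A ω‖ ^ p) (fun ω => ‖W ω‖ ^ p) μ :=
    indep ((norm_pow p).comp hA) ((norm_pow p).comp hW)
  have iAW : Integrable (fun ω => ‖A ω‖ ^ p * ‖W ω‖ ^ p) μ := hAW.integrable_mul iA iW
  have hbound : ∀ ω, ‖S ω + A ω * W ω‖ ^ p ≤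
      ‖S ω‖ ^ p + p * (g ω * W ω).re + 6 * (‖A ω‖ ^ p * ‖W ω‖ ^ p) := fun ω => by
    have := Complex.norm_add_rpow_le hp hp2 (S ω) (A ω * W ω)
    rw [norm_mul, Real.mul_rpow (norm_nonneg _) (norm_nonneg _), ← Complex.re_ofReal_mul] at this
    simpa only [hg, mul_assoc] using this
  have ire : Integrable (fun ω => p * (g ω * W ω).re) μ := (igW.re (𝕜 := ℂ)).const_mul p
  have iR : Integrable (fun ω => ‖S ω‖ ^ p + p * (g ω * W ω).re +
      6 * (‖A ω‖ ^ p * ‖W ω‖ ^ p)) μ := (iS.add ire).add (iAW.const_mul 6)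
  have iL : Integrable (fun ω => ‖S ω + A ω * W ω‖ ^ p) μ := by
    refine iR.mono' (Measurable.aestronglyMeasurable (m := mΩ)
      ((norm_pow p).comp (hS'.add (hA'.mul hW')))) (.of_forall fun ω => ?_)
    rw [Real.norm_of_nonneg (by positivity)]
    exact hbound ω
  refine ⟨iL, (integral_mono iL iR hbound).trans ?_⟩
  have hre : ∫ ω, (g ω * W ω).re ∂μ = 0 := by
    rw [integral_re_eq_re_integral igW, hgW, Complex.zero_re]
  rw [integral_add (f := fun ω => ‖S ω‖ ^ p + p * (g ω * W ω).re) (iS.add ire)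
    (iAW.const_mul 6), integral_add iS ire, integral_const_mul, integral_const_mul, hre,
    hAW.integral_fun_mul_eq_mul_integral iA.1 iW.1]
  simp

/-- A von Bahr–Esseen inequality for sums of products `A e * W e`, where `W e` is a centered
function of the variable `ξ e` and `A e` depends on variables of strictly lower rank only. -/
theorem integral_norm_sum_rpow_le [IsProbabilityMeasure μ] {ι L : Type*} [LinearOrder L]
    {p : ℝ} (hp : 1 < p) (hp2 : p ≤ 2) {ξ : ι → Ω → ℝ} (hξm : ∀ i, Measurable (ξ i))
    (hξ : iIndepFun ξ μ) (rank : ι → L) {A W : ι → Ω → ℂ}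
    (hA : ∀ e, Measurable[⨆ i ∈ {i | rank i < rank e}, MeasurableSpace.comap (ξ i) inferInstance]
      (A e))
    (hW : ∀ e, Measurable[MeasurableSpace.comap (ξ e) inferInstance] (W e))
    (iA : ∀ e, Integrable (fun ω => ‖A e ω‖ ^ p) μ)
    (iW : ∀ e, Integrable (fun ω => ‖W e ω‖ ^ p) μ) (hW0 : ∀ e, ∫ ω, W e ω ∂μ = 0)
    (s : Finset ι) :
    Integrable (fun ω => ‖∑ e ∈ s, A e ω * W e ω‖ ^ p) μ ∧
    ∫ ω, ‖∑ e ∈ s, A e ω * W e ω‖ ^ p ∂μ ≤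
      6 * ∑ e ∈ s, (∫ ω, ‖A e ω‖ ^ p ∂μ) * ∫ ω, ‖W e ω‖ ^ p ∂μ := by
  classical
  -- Peeling off an index `a` of maximal rank: the other summands and `A a` do not involve `ξ a`,
  -- even when ranks are tied.
  refine Finset.induction_on_max_value rank s ?_ ?_
  · simp [Real.zero_rpow (by linarith : p ≠ 0)]
  · intro a s has hmax ih
    set m : ι → MeasurableSpace Ω := fun i => MeasurableSpace.comap (ξ i) inferInstance with hm
    have hle : ∀ i, m i ≤ mΩ := fun i => (hξm i).comap_le
    have hI : Indep (⨆ i ∈ ({a}ᶜ : Set ι), m i) (⨆ i ∈ ({a} : Set ι), m i) μ :=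
      indep_iSup_of_disjoint hle hξ (by simp)
    have hI' : Indep (⨆ i ∈ ({a}ᶜ : Set ι), m i) (m a) μ := by simpa using hI
    have hlow : ∀ e, rank e ≤ rank a →
        (⨆ i ∈ {i | rank i < rank e}, m i) ≤ ⨆ i ∈ ({a}ᶜ : Set ι), m i := fun e he =>
      biSup_mono fun i (hi : rank i < rank e) => by
        rintro rfl
        exact absurd he (not_le.2 hi)
    have hAa : Measurable[⨆ i ∈ ({a}ᶜ : Set ι), m i] (A a) := (hA a).mono (hlow a le_rfl) le_rfl
    have hS : Measurable[⨆ i ∈ ({a}ᶜ : Set ι), m i] (fun ω => ∑ e ∈ s, A e ω * W e ω) := by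
      refine Finset.measurable_fun_sum s fun e he => ?_
      have hea : e ≠ a := fun h => has (h ▸ he)
      exact ((hA e).mono (hlow e (hmax e he)) le_rfl).mul
        ((hW e).mono (le_biSup m (i := e) (by simpa using hea)) le_rfl)
    have := integral_norm_add_mul_rpow_le hp hp2 (iSup₂_le fun i _ => hle i) (hle a) hI'
      hS hAa (hW a) ih.1 (iA a) (iW a) (hW0 a)
    simp only [Finset.sum_insert has, add_comm (A a _ * W a _), mul_add]
    refine ⟨this.1, this.2.trans ?_⟩
    have := ih.2
    linarith

end MartingaleDifference

/-! ### Gaussian weights and their moments -/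

namespace GREM

/-- The normalized weight `exp (β t x) / 𝔼 exp (β t ξ)` with `ξ` standard normal. -/
noncomputable def weight (β : ℂ) (t x : ℝ) : ℂ :=
  Complex.exp (β * t * x - (β * t) ^ 2 / 2)

/-- The `p`-th absolute moment of `weight β t ξ` with `ξ` standard normal. -/
noncomputable def weightMoment (p : ℝ) (β : ℂ) (t : ℝ) : ℝ :=
  Real.exp (t ^ 2 / 2 * (p * (p - 1) * β.re ^ 2 + p * β.im ^ 2))

theorem measurable_weight (β : ℂ) (t : ℝ) : Measurable (weight β t) := by
  unfold weight; fun_prop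

theorem weight_eq (β : ℂ) (t x : ℝ) :
    weight β t x = Complex.exp (β * t * x) * Complex.exp (-((β * t) ^ 2 / 2)) := by
  rw [weight, sub_eq_add_neg, Complex.exp_add]

theorem norm_weight_rpow (p : ℝ) (β : ℂ) (t x : ℝ) :
    ‖weight β t x‖ ^ p =
      Real.exp (p * β.re * t * x) * Real.exp (-(p * t ^ 2 * (β.re ^ 2 - β.im ^ 2) / 2)) := by
  rw [weight, Complex.norm_exp, ← Real.exp_mul, ← Real.exp_add]
  congr 1
  simp [pow_two]
  ring

theorem integral_weight (β : ℂ) (t : ℝ) : ∫ x, weight β t x ∂gaussianReal 0 1 = 1 := by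
  have h := complexMGF_id_gaussianReal (μ := 0) (v := 1) (β * t)
  simp only [complexMGF, id] at h
  simp_rw [weight_eq]
  rw [integral_mul_const, h, ← Complex.exp_add]
  simp

theorem integrable_norm_weight_rpow (p : ℝ) (β : ℂ) (t : ℝ) :
    Integrable (fun x => ‖weight β t x‖ ^ p) (gaussianReal 0 1) := by
  simp_rw [norm_weight_rpow]
  exact (integrable_exp_mul_gaussianReal _).mul_const _

theorem integral_norm_weight_rpow (p : ℝ) (β : ℂ) (t : ℝ) :
    ∫ x, ‖weight β t x‖ ^ p ∂gaussianReal 0 1 = weightMoment p β t := by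
  have h := congrFun (mgf_id_gaussianReal (μ := 0) (v := 1)) (p * β.re * t)
  simp only [mgf, id] at h
  simp_rw [norm_weight_rpow]
  rw [integral_mul_const, h, ← Real.exp_add, weightMoment]
  congr 1
  push_cast
  ring

theorem integrable_weight (β : ℂ) (t : ℝ) : Integrable (weight β t) (gaussianReal 0 1) := by
  have := integrable_norm_weight_rpow 1 β t
  simp only [Real.rpow_one] at this
  exact (integrable_norm_iff (measurable_weight β t).aestronglyMeasurable).1 this

theorem norm_sub_one_rpow_le {p : ℝ} (hp : 1 < p) (hp2 : p ≤ 2) (z : ℂ) :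
    ‖z - 1‖ ^ p ≤ 4 * (‖z‖ ^ p + 1) := by
  have h1 : ‖z - 1‖ ≤ 2 * max ‖z‖ 1 := by
    have := norm_sub_le z 1
    rw [norm_one] at this
    linarith [le_max_left ‖z‖ 1, le_max_right ‖z‖ 1]
  have hz : 0 ≤ ‖z‖ ^ p := by positivity
  calc ‖z - 1‖ ^ p ≤ (2 * max ‖z‖ 1) ^ p := by gcongr
    _ = 2 ^ p * max ‖z‖ 1 ^ p := Real.mul_rpow (by norm_num) (by positivity)
    _ ≤ 2 ^ (2 : ℝ) * max ‖z‖ 1 ^ p := by gcongr; norm_num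
    _ = 4 * max ‖z‖ 1 ^ p := by norm_num
    _ ≤ 4 * (‖z‖ ^ p + 1) := by
        gcongr
        rcases max_cases ‖z‖ 1 with h | h <;> rw [h.1]
        · linarith
        · rw [Real.one_rpow]; linarith

theorem integrable_norm_weight_sub_one_rpow {p : ℝ} (hp : 1 < p) (hp2 : p ≤ 2) (β : ℂ) (t : ℝ) :
    Integrable (fun x => ‖weight β t x - 1‖ ^ p) (gaussianReal 0 1) := by
  refine (((integrable_norm_weight_rpow p β t).add (integrable_const 1)).const_mul 4).mono'
    (((measurable_weight β t).sub_const 1).norm.pow_const _).aestronglyMeasurable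
    (.of_forall fun x => ?_)
  rw [Real.norm_of_nonneg (by positivity)]
  exact norm_sub_one_rpow_le hp hp2 _

theorem integral_norm_weight_sub_one_rpow_le {p : ℝ} (hp : 1 < p) (hp2 : p ≤ 2) (β : ℂ) (t : ℝ) :
    ∫ x, ‖weight β t x - 1‖ ^ p ∂gaussianReal 0 1 ≤ 8 * weightMoment p β t := by
  have hi := integrable_norm_weight_rpow p β t
  refine (integral_mono (integrable_norm_weight_sub_one_rpow hp hp2 β t)
    ((hi.add (integrable_const 1)).const_mul 4)
    fun x => norm_sub_one_rpow_le hp hp2 (weight β t x)).trans ?_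
  simp only [Pi.add_apply]
  rw [integral_const_mul, integral_add hi (integrable_const _), integral_norm_weight_rpow]
  -- Absorbs the additive `1`, turning `4 * (moment + 1)` into `8 * moment`.
  have : 1 ≤ weightMoment p β t := by
    refine Real.one_le_exp ?_
    have : 0 ≤ p - 1 := by linarith
    positivity
  simp
  linarith

/-! ### Martingale decomposition along the tree -/

variable {d : ℕ} {N : Fin d → ℕ}

/-- The ancestor at level `i` of the edge `e`. -/
def Edge.ancestor (e : Edge N) (i : Fin d) (h : i ≤ e.1) : Edge N :=
  ⟨i, fun k => e.2 ⟨k.1, k.2.trans h⟩⟩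

/-- The law of the family of independent standard normal variables on the edges. -/
noncomputable def edgeLaw (N : Fin d → ℕ) : Measure (Edge N → ℝ) :=
  Measure.pi fun _ => gaussianReal 0 1

instance : IsProbabilityMeasure (edgeLaw N) := by unfold edgeLaw; infer_instance

/-- The partition function divided by its expectation, with standard deviations `t`. -/
noncomputable def normalizedPartition (N : Fin d → ℕ) (t : Fin d → ℝ) (β : ℂ)
    (x : Edge N → ℝ) : ℂ :=
  (∏ j, (N j : ℂ))⁻¹ * ∑ ε : Leaf N, ∏ j, weight β (t j) (x (ε.edge j))

/-- The part of a summand of `normalizedPartition` that is determined above the edge `e`. -/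
noncomputable def pastWeight (t : Fin d → ℝ) (β : ℂ) (e : Edge N) (x : Edge N → ℝ) : ℂ :=
  (∏ i : {i // i ≤ e.1}, (N i : ℂ))⁻¹ *
    ∏ i : {i // i < e.1}, weight β (t i) (x (e.ancestor i i.2.le))

/-- Each choice of the coordinates in `q` extends to a leaf in as many ways as there are choices of
the others. This converts sums over leaves into sums over edges. -/
theorem sum_restrict_eq {M : Type*} [CommSemiring M] (q : Fin d → Prop) [DecidablePred q]
    (F : ((i : {i // q i}) → Fin (N i)) → M) :
    ∑ ε : Leaf N, F (fun i => ε i) = (∏ i : {i // ¬ q i}, (N i : M)) * ∑ v, F v := by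
  rw [← Equiv.sum_comp (Equiv.piEquivPiSubtypeProd q fun i => Fin (N i)).symm,
    Fintype.sum_prod_type]
  have : ∀ v w, F (fun i => (Equiv.piEquivPiSubtypeProd q fun i => Fin (N i)).symm (v, w) i) = F v :=
    fun v w => by
      congr 1
      ext i
      simp [Equiv.piEquivPiSubtypeProd, i.2]
  simp only [this, Finset.sum_const, Finset.card_univ, Fintype.card_pi, Fintype.card_fin,
    nsmul_eq_mul, Nat.cast_prod, Finset.mul_sum]

/-- Telescoping: the factors are replaced by `1` one at a time from the last, so only earlier
factors accompany `w j - 1`. -/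
theorem prod_sub_one_eq_sum (w : Fin d → ℂ) :
    ∏ j, w j - 1 = ∑ j, (∏ i : {i // i < j}, w i) * (w j - 1) := by
  have h := Finset.prod_add_ordered Finset.univ (fun _ : Fin d => (1 : ℂ)) (fun j => w j - 1)
  simp only [add_sub_cancel, Finset.prod_const_one, mul_one] at h
  rw [h, add_sub_cancel_left]
  refine Finset.sum_congr rfl fun j _ => ?_
  rw [mul_comm, Finset.prod_subtype (Finset.univ.filter (· < j)) (p := fun i => i < j) (by simp) w]

/-- The martingale decomposition of the normalized partition function. -/
theorem normalizedPartition_sub_one (hN : ∀ j, 0 < N j) (t : Fin d → ℝ) (β : ℂ) (x : Edge N → ℝ) :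
    normalizedPartition N t β x - 1 =
      ∑ e : Edge N, pastWeight t β e x * (weight β (t e.1) (x e) - 1) := by
  have hN0 : ∀ j, (N j : ℂ) ≠ 0 := fun j => Nat.cast_ne_zero.2 (hN j).ne'
  have hP : ∏ j, (N j : ℂ) ≠ 0 := Finset.prod_ne_zero_iff.2 fun j _ => hN0 j
  have hcard : (∏ j, (N j : ℂ))⁻¹ * ∑ _ε : Leaf N, (1 : ℂ) = 1 := by
    simp [hP]
  have h1 : normalizedPartition N t β x - 1 = (∏ j, (N j : ℂ))⁻¹ *
      ∑ ε : Leaf N, (∏ j, weight β (t j) (x (ε.edge j)) - 1) := by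
    rw [Finset.sum_sub_distrib, mul_sub, hcard, normalizedPartition]
  simp_rw [h1, prod_sub_one_eq_sum]
  rw [Finset.sum_comm, Fintype.sum_sigma, Finset.mul_sum]
  refine Finset.sum_congr rfl fun j _ => ?_
  have h2 := sum_restrict_eq (M := ℂ) (N := N) (fun i => i ≤ j) fun v =>
    (∏ i : {i // i < j}, weight β (t i) (x (Edge.ancestor ⟨j, v⟩ i i.2.le))) *
      (weight β (t j) (x ⟨j, v⟩) - 1)
  refine (congrArg _ h2).trans ?_
  -- The number of leaves below an edge cancels the part of the normalization beyond level `j`.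
  have h3 := Fintype.prod_subtype_mul_prod_subtype (fun i => i ≤ j) fun i => (N i : ℂ)
  have h4 : ∏ i : {i // ¬ i ≤ j}, (N i : ℂ) ≠ 0 := Finset.prod_ne_zero_iff.2 fun i _ => hN0 i
  rw [← h3, mul_inv, ← mul_assoc, inv_mul_cancel_right₀ h4, Finset.mul_sum]
  exact Finset.sum_congr rfl fun v _ => by simp only [pastWeight, mul_assoc]

theorem measurable_pastWeight (t : Fin d → ℝ) (β : ℂ) (e : Edge N) :
    Measurable[⨆ i ∈ {i : Edge N | i.1 < e.1},
      MeasurableSpace.comap (fun x : Edge N → ℝ => x i) inferInstance] (pastWeight t β e) := by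
  unfold pastWeight
  refine Measurable.const_mul ?_ _
  refine Finset.measurable_fun_prod _ fun i _ => ?_
  refine (measurable_weight β (t i)).comp ?_
  refine Measurable.mono (comap_measurable fun x : Edge N → ℝ => x (e.ancestor i i.2.le)) ?_ le_rfl
  exact le_biSup (fun i : Edge N => MeasurableSpace.comap (fun x : Edge N → ℝ => x i) inferInstance)
    (i := e.ancestor i i.2.le) (show (i : Fin d) < e.1 from i.2)

theorem integral_edgeLaw_eval {E : Type*} [NormedAddCommGroup E] [NormedSpace ℝ E] (e : Edge N)
    {f : ℝ → E} (hf : AEStronglyMeasurable f (gaussianReal 0 1)) :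
    ∫ x, f (x e) ∂edgeLaw N = ∫ y, f y ∂gaussianReal 0 1 :=
  integral_comp_eval (μ := fun _ : Edge N => gaussianReal 0 1) (i := e) hf

theorem iIndepFun_edgeLaw : iIndepFun (fun (e : Edge N) (x : Edge N → ℝ) => x e) (edgeLaw N) :=
  iIndepFun_pi (μ := fun _ : Edge N => gaussianReal 0 1) (X := fun _ y => y)
    fun _ => aemeasurable_id

/-- The ancestors lie on distinct levels, hence are distinct edges with independent weights, and the
moment factorizes. -/
theorem integral_norm_pastWeight_rpow (t : Fin d → ℝ) (β : ℂ) (e : Edge N) (p : ℝ) :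
    ∫ x, ‖pastWeight t β e x‖ ^ p ∂edgeLaw N =
      ((∏ i : {i // i ≤ e.1}, (N i : ℝ)) ^ p)⁻¹ *
        ∏ i : {i // i < e.1}, weightMoment p β (t i) := by
  have hinj : Function.Injective fun i : {i // i < e.1} => e.ancestor i i.2.le := fun i k h =>
    Subtype.ext (congrArg Sigma.fst h)
  have hmeas : ∀ i : {i // i < e.1}, Measurable fun y => ‖weight β (t i) y‖ ^ p := fun i =>
    (measurable_weight β (t i)).norm.pow_const _
  have hind := (iIndepFun_edgeLaw.precomp hinj).comp _ hmeas
  have hprod := hind.integral_fun_prod_eq_prod_integral fun i =>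
    ((hmeas i).comp (measurable_pi_apply _)).aestronglyMeasurable
  have hpt : ∀ x : Edge N → ℝ, ‖pastWeight t β e x‖ ^ p =
      ((∏ i : {i // i ≤ e.1}, (N i : ℝ)) ^ p)⁻¹ *
        ∏ i : {i // i < e.1}, ‖weight β (t i) (x (e.ancestor i i.2.le))‖ ^ p := fun x => by
    rw [pastWeight, norm_mul, Real.mul_rpow (norm_nonneg _) (norm_nonneg _), norm_inv,
      Real.inv_rpow (norm_nonneg _), norm_prod, norm_prod,
      Real.finsetProd_rpow _ _ fun i _ => norm_nonneg _]
    simp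
  simp_rw [hpt]
  rw [integral_const_mul]
  congr 1
  refine hprod.trans (Finset.prod_congr rfl fun i _ => ?_)
  rw [← integral_norm_weight_rpow]
  exact integral_edgeLaw_eval _ (hmeas i).aestronglyMeasurable

theorem weightMoment_pos (p : ℝ) (β : ℂ) (t : ℝ) : 0 < weightMoment p β t := Real.exp_pos _

/-- Bound on the `p`-th moment of the deviation of the normalized partition function from `1`. -/
theorem integral_norm_normalizedPartition_sub_one_rpow_le {p : ℝ} (hp : 1 < p) (hp2 : p ≤ 2)
    (hN : ∀ j, 0 < N j) (t : Fin d → ℝ) (β : ℂ) :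
    Integrable (fun x => ‖normalizedPartition N t β x - 1‖ ^ p) (edgeLaw N) ∧
    ∫ x, ‖normalizedPartition N t β x - 1‖ ^ p ∂edgeLaw N ≤
      48 * ∑ j, ∏ i ∈ Finset.Iic j, ((N i : ℝ) ^ (1 - p) * weightMoment p β (t i)) := by
  have hNpos : ∀ j, (0 : ℝ) < N j := fun j => Nat.cast_pos.2 (hN j)
  have iA : ∀ e : Edge N, Integrable (fun x => ‖pastWeight t β e x‖ ^ p) (edgeLaw N) := fun e => by
    -- A nonzero Bochner integral forces integrability, and the computed value is positive.
    refine not_imp_comm.1 integral_undef ?_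
    rw [integral_norm_pastWeight_rpow]
    have h1 : (0 : ℝ) < ∏ i : {i // i ≤ e.1}, (N i : ℝ) := Finset.prod_pos fun i _ => hNpos i
    have h2 : (0 : ℝ) < ∏ i : {i // i < e.1}, weightMoment p β (t i) :=
      Finset.prod_pos fun i _ => weightMoment_pos _ _ _
    positivity
  have iW : ∀ e : Edge N, Integrable (fun x => ‖weight β (t e.1) (x e) - 1‖ ^ p) (edgeLaw N) :=
    fun e => integrable_comp_eval (μ := fun _ : Edge N => gaussianReal 0 1) (i := e)
      (integrable_norm_weight_sub_one_rpow hp hp2 β (t e.1))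
  have hW0 : ∀ e : Edge N, ∫ x, (weight β (t e.1) (x e) - 1) ∂edgeLaw N = 0 := fun e => by
    have hi := integrable_weight β (t e.1)
    rw [integral_edgeLaw_eval e (f := fun y => weight β (t e.1) y - 1)
      (hi.sub (integrable_const 1)).1, integral_sub hi (integrable_const 1), integral_weight]
    simp
  have hmain := integral_norm_sum_rpow_le hp hp2 (fun e : Edge N => measurable_pi_apply e)
    iIndepFun_edgeLaw (fun e => e.1) (A := pastWeight t β)
    (W := fun e x => weight β (t e.1) (x e) - 1) (measurable_pastWeight t β)
    (fun e => ((measurable_weight β (t e.1)).sub_const 1).comp (comap_measurable _))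
    iA iW hW0 Finset.univ
  simp_rw [normalizedPartition_sub_one hN]
  refine ⟨hmain.1, hmain.2.trans ?_⟩
  -- `6` is the von Bahr–Esseen constant, `8` the cost of centering a weight.
  rw [show (48 : ℝ) = 6 * 8 by norm_num, mul_assoc]
  refine mul_le_mul_of_nonneg_left ?_ (by norm_num)
  rw [Fintype.sum_sigma, Finset.mul_sum]
  refine Finset.sum_le_sum fun j _ => ?_
  set Q : ℝ := ∏ i : {i // i ≤ j}, (N i : ℝ) with hQ
  have hQpos : 0 < Q := Finset.prod_pos fun i _ => hNpos i
  have hterm : ∀ v : (i : {i // i ≤ j}) → Fin (N i),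
      (∫ x, ‖pastWeight t β ⟨j, v⟩ x‖ ^ p ∂edgeLaw N) *
        ∫ x, ‖weight β (t j) (x ⟨j, v⟩) - 1‖ ^ p ∂edgeLaw N ≤
      (Q ^ p)⁻¹ * (8 * ∏ i ∈ Finset.Iic j, weightMoment p β (t i)) := fun v => by
    rw [integral_norm_pastWeight_rpow, mul_assoc]
    refine mul_le_mul_of_nonneg_left ?_ (by positivity)
    rw [integral_edgeLaw_eval ⟨j, v⟩ (f := fun y => ‖weight β (t j) y - 1‖ ^ p)
      (integrable_norm_weight_sub_one_rpow hp hp2 β (t j)).1]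
    have h2 : (0 : ℝ) ≤ ∏ i : {i // i < j}, weightMoment p β (t i) :=
      Finset.prod_nonneg fun i _ => (weightMoment_pos _ _ _).le
    refine (mul_le_mul_of_nonneg_left (integral_norm_weight_sub_one_rpow_le hp hp2 β (t j))
      h2).trans (le_of_eq ?_)
    rw [← Finset.prod_subtype (Finset.Iio j) (by simp) fun i => weightMoment p β (t i),
      ← Finset.Iio_insert, Finset.prod_insert (by simp)]
    ring
  -- There are `Q` edges at level `j`, so the total power is `Q * Q ^ (-p) = Q ^ (1 - p)`.
  refine (Finset.sum_le_sum fun v _ => hterm v).trans (le_of_eq ?_)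
  rw [Finset.sum_const, Finset.card_univ, Fintype.card_pi, nsmul_eq_mul, Finset.prod_mul_distrib,
    Finset.prod_subtype (Finset.Iic j) (p := fun i => i ≤ j) (by simp) fun i => (N i : ℝ) ^ (1 - p),
    Real.finsetProd_rpow _ (fun i : {i // i ≤ j} => (N i : ℝ)) fun i _ => (hNpos i).le]
  simp only [Fintype.card_fin, Nat.cast_prod]
  rw [← hQ, Real.rpow_sub hQpos, Real.rpow_one]
  field_simp

end GREM

/-! ### From moments on a circle to values in a disc -/

/-- Cauchy's formula on the circle of radius `2 * r`, which stays at distance at least `r` from `z`.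
-/
theorem norm_le_integral_circleMap {f : ℂ → ℂ} (hf : Differentiable ℂ f) {c z : ℂ}
    {r : ℝ} (hr : 0 < r) (hz : z ∈ Metric.closedBall c r) :
    ‖f z‖ ≤ Real.pi⁻¹ * ∫ θ in (0)..(2 * Real.pi), ‖f (circleMap c (2 * r) θ)‖ := by
  have hpi := Real.pi_pos
  have hdist : dist z c ≤ r := hz
  have hC := (hf.diffContOnCl (s := Metric.ball c (2 * r))).circleIntegral_sub_inv_smul
    (w := z) (by rw [Metric.mem_ball]; linarith)
  have hgap : ∀ θ, r ≤ ‖circleMap c (2 * r) θ - z‖ := fun θ => by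
    have h1 : dist (circleMap c (2 * r) θ) c = 2 * r := circleMap_mem_sphere c (by linarith) θ
    have h2 := dist_triangle (circleMap c (2 * r) θ) z c
    rw [← dist_eq_norm]
    linarith
  have hbound : ∀ θ, ‖deriv (circleMap c (2 * r)) θ •
      ((circleMap c (2 * r) θ - z)⁻¹ • f (circleMap c (2 * r) θ))‖ ≤
      2 * ‖f (circleMap c (2 * r) θ)‖ := fun θ => by
    have h1 : ‖circleMap c (2 * r) θ - z‖⁻¹ ≤ r⁻¹ := inv_anti₀ hr (hgap θ)
    have h2 : ‖deriv (circleMap c (2 * r)) θ‖ = 2 * r := by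
      simp [deriv_circleMap, abs_of_pos hr]
    rw [norm_smul, norm_smul, norm_inv, h2, ← mul_assoc]
    gcongr
    calc 2 * r * ‖circleMap c (2 * r) θ - z‖⁻¹ ≤ 2 * r * r⁻¹ := by gcongr
      _ = 2 := by field_simp
  have hcont : Continuous fun θ => 2 * ‖f (circleMap c (2 * r) θ)‖ :=
    ((hf.continuous.comp (continuous_circleMap c (2 * r))).norm).const_mul 2
  have hint := intervalIntegral.norm_integral_le_of_norm_le (μ := volume)
    (by linarith : (0 : ℝ) ≤ 2 * Real.pi) (.of_forall fun θ _ => hbound θ)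
    (hcont.intervalIntegrable _ _)
  rw [circleIntegral] at hC
  rw [hC, intervalIntegral.integral_const_mul, norm_smul] at hint
  have h2pi : ‖(2 * (Real.pi : ℂ) * Complex.I)‖ = 2 * Real.pi := by
    simp [abs_of_pos hpi]
  rw [h2pi] at hint
  rw [← div_eq_inv_mul, le_div_iff₀ hpi]
  linarith

/-- Over the circle the constant `1 / 4` integrates to `π / 2`, half of the lower bound `π` that
Cauchy's formula gives; the `p`-th powers must supply the rest. -/
theorem le_quarter_add_rpow {u p : ℝ} (hu : 0 ≤ u) (hp : 1 ≤ p) (hp2 : p ≤ 2) :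
    u ≤ 1 / 4 + 4 * u ^ p := by
  have h := le_one_add_rpow (u := 4 * u) (by linarith) hp
  rw [Real.mul_rpow (by norm_num) hu] at h
  have h4 : (4 : ℝ) ^ p ≤ 4 ^ (2 : ℝ) := Real.rpow_le_rpow_of_exponent_le (by norm_num) hp2
  have h5 : (4 : ℝ) ^ (2 : ℝ) = 16 := by norm_num
  have : 0 ≤ u ^ p := by positivity
  nlinarith

theorem le_integral_circleMap_rpow {f : ℂ → ℂ} (hf : Differentiable ℂ f) {c z : ℂ}
    {r p : ℝ} (hr : 0 < r) (hz : z ∈ Metric.closedBall c r) (hp : 1 < p) (hp2 : p ≤ 2)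
    (h1 : ‖f z‖ = 1) :
    Real.pi / 8 ≤ ∫ θ in (0)..(2 * Real.pi), ‖f (circleMap c (2 * r) θ)‖ ^ p := by
  have hpi := Real.pi_pos
  have hn : Continuous fun θ => ‖f (circleMap c (2 * r) θ)‖ :=
    (hf.continuous.comp (continuous_circleMap c (2 * r))).norm
  have hnp : Continuous fun θ => 4 * ‖f (circleMap c (2 * r) θ)‖ ^ p :=
    (hn.rpow_const fun _ => Or.inr (by linarith)).const_mul 4
  have h := norm_le_integral_circleMap hf hr hz
  rw [h1, ← div_eq_inv_mul, le_div_iff₀ hpi] at h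
  have hmono := intervalIntegral.integral_mono_on (μ := volume)
    (g := fun θ => 1 / 4 + 4 * ‖f (circleMap c (2 * r) θ)‖ ^ p)
    (by linarith : (0 : ℝ) ≤ 2 * Real.pi) (hn.intervalIntegrable _ _)
    ((continuous_const.add hnp).intervalIntegrable _ _)
    fun θ _ => le_quarter_add_rpow (norm_nonneg (f (circleMap c (2 * r) θ))) hp.le hp2
  rw [intervalIntegral.integral_add (continuous_const.intervalIntegrable _ _)
    (hnp.intervalIntegrable _ _), intervalIntegral.integral_const_mul] at hmono
  simp at hmono
  linarith

/-- For a random entire function whose `p`-th moments are at most `B` on a disc, the probability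
that it takes a value of modulus `1` on the concentric disc of half the radius is at most `16 B`. -/
theorem measure_exists_norm_eq_one_le {X : Type*} [TopologicalSpace X]
    [SecondCountableTopology X] [MeasurableSpace X] [BorelSpace X] {P : Measure X} [SFinite P]
    {f : ℂ → X → ℂ} (hd : ∀ x, Differentiable ℂ fun β => f β x)
    (hf : Continuous (Function.uncurry f)) {p : ℝ} (hp : 1 < p) (hp2 : p ≤ 2)
    (hi : ∀ β, Integrable (fun x => ‖f β x‖ ^ p) P) {c : ℂ} {r B : ℝ} (hr : 0 < r)
    (hB : ∀ β ∈ Metric.closedBall c (2 * r), ∫ x, ‖f β x‖ ^ p ∂P ≤ B) :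
    P {x | ∃ β ∈ Metric.closedBall c r, ‖f β x‖ = 1} ≤ ENNReal.ofReal (16 * B) := by
  have hpi := Real.pi_pos
  have hFc : Continuous fun q : X × ℝ => ‖f (circleMap c (2 * r) q.2) q.1‖ ^ p :=
    (hf.comp (((continuous_circleMap c (2 * r)).comp continuous_snd).prodMk
      continuous_fst)).norm.rpow_const fun _ => Or.inr (by linarith)
  have hF0 : ∀ x θ, 0 ≤ ‖f (circleMap c (2 * r) θ) x‖ ^ p := fun x θ => by positivity
  have hFm : Measurable (Function.uncurry fun (x : X) (θ : ℝ) =>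
      ENNReal.ofReal (‖f (circleMap c (2 * r) θ) x‖ ^ p)) :=
    hFc.measurable.ennreal_ofReal
  set G : X → ENNReal := fun x =>
    ∫⁻ θ in Set.Ioc 0 (2 * Real.pi), ENNReal.ofReal (‖f (circleMap c (2 * r) θ) x‖ ^ p) with hG
  have hGm : Measurable G := hFm.lintegral_prod_right'
  -- The superset is defined by the measurable `G`, so measurability of the event itself is never
  -- needed.
  have hsub : {x | ∃ β ∈ Metric.closedBall c r, ‖f β x‖ = 1} ⊆
      {x | ENNReal.ofReal (Real.pi / 8) ≤ G x} := by
    rintro x ⟨β, hβ, h1⟩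
    have h := le_integral_circleMap_rpow (hd x) hr hβ hp hp2 h1
    have hcx : Continuous fun θ : ℝ => ‖f (circleMap c (2 * r) θ) x‖ ^ p :=
      ((hd x).continuous.comp (continuous_circleMap c (2 * r))).norm.rpow_const
        fun _ => Or.inr (by linarith)
    have hix : IntegrableOn (fun θ : ℝ => ‖f (circleMap c (2 * r) θ) x‖ ^ p)
        (Set.Ioc 0 (2 * Real.pi)) := hcx.integrableOn_Ioc
    rw [intervalIntegral.integral_of_le (by linarith)] at h
    exact (ENNReal.ofReal_le_ofReal h).trans_eq
      (ofReal_integral_eq_lintegral_ofReal hix (.of_forall fun θ => hF0 x θ))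
  have hmarkov := mul_meas_ge_le_lintegral (μ := P) hGm (ENNReal.ofReal (Real.pi / 8))
  have hswap : ∫⁻ x, G x ∂P ≤ ENNReal.ofReal (2 * Real.pi * B) := by
    rw [lintegral_lintegral_swap hFm.aemeasurable]
    calc ∫⁻ θ in Set.Ioc 0 (2 * Real.pi), ∫⁻ x,
          ENNReal.ofReal (‖f (circleMap c (2 * r) θ) x‖ ^ p) ∂P
        ≤ ∫⁻ _θ in Set.Ioc 0 (2 * Real.pi), ENNReal.ofReal B := by
          refine lintegral_mono fun θ => ?_
          rw [← ofReal_integral_eq_lintegral_ofReal (hi _) (.of_forall fun x => hF0 x θ)]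
          refine ENNReal.ofReal_le_ofReal (hB _ ?_)
          exact Metric.sphere_subset_closedBall (circleMap_mem_sphere c (by linarith) θ)
      _ = ENNReal.ofReal (2 * Real.pi * B) := by
          rw [setLIntegral_const, Real.volume_Ioc, sub_zero, mul_comm,
            ← ENNReal.ofReal_mul (by linarith)]
  refine (measure_mono hsub).trans ?_
  have hpos : ENNReal.ofReal (Real.pi / 8) ≠ 0 := by simpa using hpi
  have h := hmarkov.trans hswap
  -- `16` is the circle's angular length `2π` divided by the threshold `π / 8`.
  rw [show 2 * Real.pi * B = Real.pi / 8 * (16 * B) by ring,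
    ENNReal.ofReal_mul (by linarith)] at h
  exact (ENNReal.mul_le_mul_iff_right hpos ENNReal.ofReal_ne_top).1 h

/-! ### Zeros and decay level by level -/

namespace GREM

variable {d : ℕ} {N : Fin d → ℕ}

/-- The Gaussian normalization of a summand depends only on the levels, not on the leaf, so it
factors out of the sum. -/
theorem normalizedPartition_eq_zero {a : Fin d → ℝ} {n : ℕ} {x : Edge N → ℝ} {β : ℂ}
    (h : partitionFunction a n x β = 0) :
    normalizedPartition N (fun j => Real.sqrt n * Real.sqrt (a j)) β x = 0 := by
  have : ∀ ε : Leaf N,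
      ∏ j, weight β (Real.sqrt n * Real.sqrt (a j)) (x (ε.edge j)) =
        Complex.exp (β * (Real.sqrt n : ℂ) * (energy a x ε : ℂ)) *
          ∏ j, Complex.exp (-((β * (Real.sqrt n * Real.sqrt (a j) : ℝ)) ^ 2 / 2)) := fun ε => by
    simp_rw [weight_eq]
    rw [Finset.prod_mul_distrib, ← Complex.exp_sum, energy]
    congr 2
    push_cast
    rw [Finset.mul_sum]
    exact Finset.sum_congr rfl fun j _ => by ring
  rw [normalizedPartition, Finset.sum_congr rfl fun ε _ => this ε, ← Finset.sum_mul]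
  rw [partitionFunction] at h
  rw [h, zero_mul, mul_zero]

theorem differentiable_normalizedPartition (t : Fin d → ℝ) (x : Edge N → ℝ) :
    Differentiable ℂ fun β => normalizedPartition N t β x := by
  unfold normalizedPartition weight
  fun_prop

theorem continuous_normalizedPartition {X : Type*} [TopologicalSpace X] (t : Fin d → ℝ)
    {b : X → ℂ} {x : X → Edge N → ℝ} (hb : Continuous b) (hx : Continuous x) :
    Continuous fun q => normalizedPartition N t (b q) (x q) := by
  unfold normalizedPartition weight
  fun_prop

theorem edgeLaw_exists_zero_le {p : ℝ} (hp : 1 < p) (hp2 : p ≤ 2) (hN : ∀ j, 0 < N j)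
    (t : Fin d → ℝ) {c : ℂ} {r B : ℝ} (hr : 0 < r)
    (hB : ∀ β ∈ Metric.closedBall c (2 * r),
      ∫ x, ‖normalizedPartition N t β x - 1‖ ^ p ∂edgeLaw N ≤ B) :
    edgeLaw N {x | ∃ β ∈ Metric.closedBall c r, normalizedPartition N t β x = 0} ≤
      ENNReal.ofReal (16 * B) := by
  have h := measure_exists_norm_eq_one_le (P := edgeLaw N)
    (f := fun β x => normalizedPartition N t β x - 1)
    (fun x => (differentiable_normalizedPartition t x).sub_const 1)
    ((continuous_normalizedPartition t continuous_fst continuous_snd).sub continuous_const) hp hp2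
    (fun β => (integral_norm_normalizedPartition_sub_one_rpow_le hp hp2 hN t β).1) hr hB
  refine (measure_mono ?_).trans h
  rintro x ⟨β, hβ, h0⟩
  exact ⟨β, hβ, by simp [h0]⟩

/-- One level of the tree contributes an exponentially small factor. -/
theorem rpow_mul_weightMoment_le {p : ℝ} (hp : 1 < p) (hp2 : p ≤ 2) {a α : ℝ} (ha : 0 < a)
    (hα : 1 < α) {n m : ℕ} (hm : α ^ n / 2 ≤ m) {β : ℂ} {δ κ : ℝ}
    (hβ : p * β.re ^ 2 + p / (p - 1) * β.im ^ 2 ≤ criticalTemp a α ^ 2 - δ)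
    (hκ : κ ≤ a * (p - 1) * δ / 2) :
    (m : ℝ) ^ (1 - p) * weightMoment p β (Real.sqrt n * Real.sqrt a) ≤
      2 * Real.exp (-κ * n) := by
  have hα0 : 0 < α := by linarith
  have hlog : 0 < Real.log α := Real.log_pos hα
  have hp1 : 0 < p - 1 := by linarith
  have hn : (0 : ℝ) ≤ n := n.cast_nonneg
  have hσ : criticalTemp a α ^ 2 = 2 * Real.log α / a := Real.sq_sqrt (by positivity)
  have h1 : (m : ℝ) ^ (1 - p) ≤ 2 * Real.exp (-((p - 1) * Real.log α * n)) := by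
    have hpow : (0 : ℝ) < α ^ n := by positivity
    calc (m : ℝ) ^ (1 - p) ≤ (α ^ n / 2) ^ (1 - p) :=
          Real.rpow_le_rpow_of_nonpos (by positivity) hm (by linarith)
      _ = (α ^ n) ^ (1 - p) * 2 ^ (p - 1) := by
          rw [Real.div_rpow hpow.le (by norm_num), div_eq_mul_inv,
            ← Real.rpow_neg (by norm_num), neg_sub]
      _ ≤ (α ^ n) ^ (1 - p) * 2 ^ (1 : ℝ) := by
          gcongr
          · norm_num
          · linarith
      _ = 2 * Real.exp (-((p - 1) * Real.log α * n)) := by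
          rw [Real.rpow_one, mul_comm, Real.rpow_def_of_pos hpow, Real.log_pow]
          congr 2
          ring
  have h2 : weightMoment p β (Real.sqrt n * Real.sqrt a) ≤
      Real.exp ((p - 1) * Real.log α * n - κ * n) := by
    rw [weightMoment]
    refine Real.exp_le_exp.2 ?_
    rw [mul_pow, Real.sq_sqrt hn, Real.sq_sqrt ha.le]
    -- Extracting `p - 1` matches the moment exponent with the decay rate `(p - 1) * log α` of `m ^
    -- (1 - p)`.
    have e : p * (p - 1) * β.re ^ 2 + p * β.im ^ 2 =
        (p - 1) * (p * β.re ^ 2 + p / (p - 1) * β.im ^ 2) := by field_simp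
    rw [e]
    calc n * a / 2 * ((p - 1) * (p * β.re ^ 2 + p / (p - 1) * β.im ^ 2))
        ≤ n * a / 2 * ((p - 1) * (2 * Real.log α / a - δ)) := by rw [hσ] at hβ; gcongr
      _ = (p - 1) * Real.log α * n - a * (p - 1) * δ / 2 * n := by field_simp
      _ ≤ (p - 1) * Real.log α * n - κ * n := by gcongr
  calc (m : ℝ) ^ (1 - p) * weightMoment p β (Real.sqrt n * Real.sqrt a)
      ≤ 2 * Real.exp (-((p - 1) * Real.log α * n)) *
        Real.exp ((p - 1) * Real.log α * n - κ * n) := by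
        gcongr
        exact (weightMoment_pos _ _ _).le
    _ = 2 * Real.exp (-κ * n) := by
        rw [mul_assoc, ← Real.exp_add]
        congr 2
        ring

/-- Each product contains the factor of index `j`, so at least one `q` survives; the other powers
are at most `1`. -/
theorem sum_prod_Iic_le {f : Fin d → ℝ} {q : ℝ} (hf : ∀ j, 0 ≤ f j) (hq : 0 ≤ q) (hq1 : q ≤ 1)
    (h : ∀ j, f j ≤ 2 * q) : ∑ j, ∏ i ∈ Finset.Iic j, f i ≤ d * 2 ^ d * q := by
  have : ∀ j : Fin d, ∏ i ∈ Finset.Iic j, f i ≤ 2 ^ d * q := fun j => by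
    calc ∏ i ∈ Finset.Iic j, f i ≤ ∏ _i ∈ Finset.Iic j, (2 * q) :=
          Finset.prod_le_prod (fun i _ => hf i) fun i _ => h i
      _ = 2 ^ ((j : ℕ) + 1) * q ^ ((j : ℕ) + 1) := by
          rw [Finset.prod_const, Fin.card_Iic, mul_pow]
      _ ≤ 2 ^ d * q := by
          gcongr
          · norm_num
          · exact j.2
          · exact pow_le_of_le_one hq hq1 (by simp)
  refine (Finset.sum_le_sum fun j _ => this j).trans (le_of_eq ?_)
  simp [mul_assoc]

/-! ### The phase `E_1` and the choice of exponent -/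

theorem criticalTemp_pos {a α : ℝ} (ha : 0 < a) (hα : 1 < α) : 0 < criticalTemp a α := by
  have := Real.log_pos hα
  exact Real.sqrt_pos.2 (by positivity)

/-- A point violating both alternatives satisfies the defining inequalities of `phaseG` or `phaseF`
weakly, and the dilations `(1 + ε) β` make them strict. Such a point therefore lies in the closure.
-/
theorem lt_of_mem_phaseE {s : ℝ} (hs : 0 < s) {β : ℂ} (hβ : β ∈ phaseE s) :
    (2 * |β.re| ≤ s ∧ 2 * (β.re ^ 2 + β.im ^ 2) < s ^ 2) ∨
      (s < 2 * |β.re| ∧ |β.re| + |β.im| < s) := by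
  by_contra hcon
  rw [not_or, not_and, not_and, not_lt, not_lt] at hcon
  refine hβ ?_
  have htend : Filter.Tendsto (fun ε : ℝ => ((1 + ε : ℝ) : ℂ) * β) (nhdsWithin 0 (Set.Ioi 0))
      (nhds β) := by
    have : Continuous fun ε : ℝ => ((1 + ε : ℝ) : ℂ) * β := by fun_prop
    have h := this.tendsto 0
    simp only [add_zero, Complex.ofReal_one, one_mul] at h
    exact h.mono_left nhdsWithin_le_nhds
  refine mem_closure_of_tendsto htend ?_
  have hpos : ∀ᶠ ε : ℝ in nhdsWithin 0 (Set.Ioi 0), 0 < ε := self_mem_nhdsWithin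
  have hscale : ∀ {ε u v : ℝ}, 0 < ε → 0 < u → u ≤ v → u < (1 + ε) * v := fun hε hu huv => by
    nlinarith
  have hre : ∀ {ε : ℝ}, 0 < ε → |(((1 + ε : ℝ) : ℂ) * β).re| = (1 + ε) * |β.re| := fun hε => by
    rw [Complex.re_ofReal_mul, abs_mul, abs_of_pos (by linarith)]
  have him : ∀ {ε : ℝ}, 0 < ε → |(((1 + ε : ℝ) : ℂ) * β).im| = (1 + ε) * |β.im| := fun hε => by
    rw [Complex.im_ofReal_mul, abs_mul, abs_of_pos (by linarith)]
  have inG : s ≤ 2 * |β.re| → s ≤ |β.re| + |β.im| →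
      ∀ᶠ ε : ℝ in nhdsWithin 0 (Set.Ioi 0), ((1 + ε : ℝ) : ℂ) * β ∈ phaseG s ∪ phaseF s := by
    intro h1 h2
    filter_upwards [hpos] with ε hε
    refine Or.inl ⟨?_, ?_⟩
    · rw [hre hε]
      have := hscale hε hs h1
      linarith
    · rw [hre hε, him hε]
      have := hscale hε hs h2
      linarith
  rcases lt_trichotomy (2 * |β.re|) s with h | h | h
  · have h2 := hcon.1 h.le
    have hsmall : ∀ᶠ ε : ℝ in nhdsWithin 0 (Set.Ioi 0), 2 * ((1 + ε) * |β.re|) < s := by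
      have hc : Continuous fun ε : ℝ => 2 * ((1 + ε) * |β.re|) := by fun_prop
      have := hc.tendsto 0
      simp only [add_zero, one_mul] at this
      exact (this.mono_left nhdsWithin_le_nhds).eventually_lt_const h
    filter_upwards [hpos, hsmall] with ε hε hsm
    refine Or.inr ⟨by rw [hre hε]; exact hsm, ?_⟩
    rw [Complex.re_ofReal_mul, Complex.im_ofReal_mul]
    have h3 := hscale hε (by positivity) h2
    have h4 := hscale hε (by nlinarith) h3.le
    nlinarith
  -- Dilation leaves the strip of `phaseF` here, but `2 * |β.re| = s` forces `|β.im| ≥ |β.re|`, so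
  -- `phaseG` takes over.
  · refine inG h.ge ?_
    have h2 := hcon.1 h.le
    have h3 : |β.re| ^ 2 ≤ |β.im| ^ 2 := by
      rw [sq_abs, sq_abs]
      have : s ^ 2 = 4 * β.re ^ 2 := by rw [← h, mul_pow, sq_abs]; norm_num
      linarith
    have := (pow_le_pow_iff_left₀ (abs_nonneg _) (abs_nonneg _) two_ne_zero).1 h3
    linarith
  · exact inG h.le (hcon.2 h)

/-- In the expectation dominated phase some conjugate pair of exponents makes the weighted sum of
squares smaller than the square of the critical inverse temperature. -/
theorem exists_exponent_of_mem_phaseE {s : ℝ} (hs : 0 < s) {β : ℂ} (hβ : β ∈ phaseE s) :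
    ∃ p : ℝ, 1 < p ∧ p ≤ 2 ∧ p * β.re ^ 2 + p / (p - 1) * β.im ^ 2 < s ^ 2 := by
  rcases lt_of_mem_phaseE hs hβ with ⟨_, h⟩ | ⟨h1, h2⟩
  · exact ⟨2, by norm_num, le_rfl, by norm_num; linarith⟩
  have hx : 0 < |β.re| := by linarith
  -- On the real axis the infimum is approached only as `p` tends to `1`. Otherwise `p = 1 + |β.im|
  -- / |β.re|` is the minimizer, with value `(|β.re| + |β.im|) ^ 2`.
  rcases eq_or_ne β.im 0 with h0 | h0
  · rw [h0, abs_zero, add_zero] at h2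
    have hlt : β.re ^ 2 < s ^ 2 := by rw [← sq_abs]; gcongr
    have hx2 : 0 < β.re ^ 2 := by rw [← sq_abs]; positivity
    obtain ⟨p, hp1, hp2⟩ := exists_between
      (lt_min ((one_lt_div hx2).2 hlt) (by norm_num : (1 : ℝ) < 2))
    refine ⟨p, hp1, (hp2.trans_le (min_le_right _ _)).le, ?_⟩
    have := (lt_div_iff₀ hx2).1 (hp2.trans_le (min_le_left _ _))
    simpa [h0] using this
  · have hy : 0 < |β.im| := abs_pos.2 h0
    refine ⟨1 + |β.im| / |β.re|, by linarith [div_pos hy hx], ?_, ?_⟩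
    · have : |β.im| / |β.re| ≤ 1 := (div_le_one hx).2 (by linarith)
      linarith
    · have : (1 + |β.im| / |β.re|) * β.re ^ 2 +
          (1 + |β.im| / |β.re|) / (1 + |β.im| / |β.re| - 1) * β.im ^ 2 =
          (|β.re| + |β.im|) ^ 2 := by
        rw [← sq_abs β.re, ← sq_abs β.im, add_sub_cancel_left]
        field_simp
      rw [this]
      gcongr

/-! ### Exponentially small probabilities: local bounds and transfer -/

/-- The zeros of the partition function in `S` have exponentially small probability. -/
def ExpSmallZeros (a : Fin d → ℝ) (N : ℕ → Fin d → ℕ) (S : Set ℂ) : Prop :=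
  ∃ C > (0 : ℝ), ∃ ε > (0 : ℝ), ∀ n : ℕ,
    edgeLaw (N n) {x | ∃ β ∈ S, partitionFunction a n x β = 0} ≤
      ENNReal.ofReal (C * Real.exp (-ε * n))

theorem ExpSmallZeros.mono {a : Fin d → ℝ} {N : ℕ → Fin d → ℕ} {S T : Set ℂ} (h : S ⊆ T)
    (hT : ExpSmallZeros a N T) : ExpSmallZeros a N S := by
  obtain ⟨C, hC, ε, hε, H⟩ := hT
  refine ⟨C, hC, ε, hε, fun n => (measure_mono ?_).trans (H n)⟩
  rintro x ⟨β, hβ, h0⟩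
  exact ⟨β, h hβ, h0⟩

theorem ExpSmallZeros.union {a : Fin d → ℝ} {N : ℕ → Fin d → ℕ} {S T : Set ℂ}
    (hS : ExpSmallZeros a N S) (hT : ExpSmallZeros a N T) : ExpSmallZeros a N (S ∪ T) := by
  obtain ⟨C, hC, ε, hε, H⟩ := hS
  obtain ⟨C', hC', ε', hε', H'⟩ := hT
  refine ⟨C + C', by positivity, min ε ε', lt_min hε hε', fun n => ?_⟩
  have hset : {x : Edge (N n) → ℝ | ∃ β ∈ S ∪ T, partitionFunction a n x β = 0} =
      {x | ∃ β ∈ S, partitionFunction a n x β = 0} ∪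
        {x | ∃ β ∈ T, partitionFunction a n x β = 0} := by
    ext x
    simp only [Set.mem_union, Set.mem_ofPred_eq, or_and_right, exists_or]
  rw [hset]
  refine (measure_union_le _ _).trans ((add_le_add (H n) (H' n)).trans ?_)
  rw [← ENNReal.ofReal_add (by positivity) (by positivity), add_mul]
  gcongr
  · exact min_le_left _ _
  · exact min_le_right _ _

theorem ExpSmallZeros.of_eventually {a : Fin d → ℝ} {N : ℕ → Fin d → ℕ} {S : Set ℂ} {C ε : ℝ}
    (hC : 0 < C) (hε : 0 < ε)
    (H : ∀ᶠ n : ℕ in Filter.atTop,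
      edgeLaw (N n) {x | ∃ β ∈ S, partitionFunction a n x β = 0} ≤
        ENNReal.ofReal (C * Real.exp (-ε * n))) : ExpSmallZeros a N S := by
  obtain ⟨m, hm⟩ := Filter.eventually_atTop.1 H
  -- With this constant the bound is at least `1` for every `n ≤ m`.
  refine ⟨max C (Real.exp (ε * m)), by positivity, ε, hε, fun n => ?_⟩
  rcases le_total m n with h | h
  · refine (hm n h).trans (ENNReal.ofReal_le_ofReal ?_)
    gcongr
    exact le_max_left _ _
  · refine prob_le_one.trans (ENNReal.one_le_ofReal.2 ?_)
    have h' : (n : ℝ) ≤ m := Nat.cast_le.2 h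
    calc (1 : ℝ) ≤ Real.exp (ε * m) * Real.exp (-ε * n) := by
          rw [← Real.exp_add]
          exact Real.one_le_exp (by nlinarith)
      _ ≤ _ := by gcongr; exact le_max_right _ _

/-- The exponent found at `c` works in a whole disc by continuity, with margin `s ^ 2 - b`, and at
every level because `s` is below all critical values. -/
theorem exists_nhds_expSmallZeros {a α : Fin d → ℝ} (ha : ∀ j, 0 < a j) (hα : ∀ j, 1 < α j)
    {N : ℕ → Fin d → ℕ}
    (hN : ∀ j, Filter.Tendsto (fun n : ℕ => (N n j : ℝ) / α j ^ n) Filter.atTop (nhds 1))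
    {s : ℝ} (hs : 0 < s) (hsσ : ∀ j, s ≤ criticalTemp (a j) (α j)) {c : ℂ} (hc : c ∈ phaseE s) :
    ∃ U ∈ nhds c, ExpSmallZeros a N U := by
  obtain ⟨p, hp, hp2, hlt⟩ := exists_exponent_of_mem_phaseE hs hc
  have hp1 : 0 < p - 1 := by linarith
  obtain ⟨b, hb1, hb2⟩ := exists_between hlt
  have hcont : Continuous fun β : ℂ => p * β.re ^ 2 + p / (p - 1) * β.im ^ 2 := by fun_prop
  have hev : ∀ᶠ β in nhds c, p * β.re ^ 2 + p / (p - 1) * β.im ^ 2 < b :=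
    (hcont.tendsto c).eventually_lt_const hb1
  obtain ⟨R, hR, hball⟩ := Metric.nhds_basis_closedBall.mem_iff.1 hev
  obtain ⟨κ, hκ, hκle⟩ : ∃ κ > 0, ∀ j, κ ≤ a j * (p - 1) * (s ^ 2 - b) / 2 := by
    have hpos : ∀ j, 0 < a j * (p - 1) * (s ^ 2 - b) / 2 := fun j =>
      div_pos (mul_pos (mul_pos (ha j) hp1) (by linarith)) two_pos
    rcases isEmpty_or_nonempty (Fin d) with he | he
    · exact ⟨1, one_pos, fun j => he.elim j⟩
    · obtain ⟨j, hj⟩ := Finite.exists_min fun j => a j * (p - 1) * (s ^ 2 - b) / 2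
      exact ⟨_, hpos j, hj⟩
  -- The radius is halved because moments are needed on the doubled disc; `+ 1` keeps the constant
  -- positive when `d = 0`.
  refine ⟨Metric.closedBall c (R / 2), Metric.closedBall_mem_nhds c (by linarith),
    ExpSmallZeros.of_eventually (C := 16 * (48 * (d * 2 ^ d)) + 1) (ε := κ) (by positivity) hκ ?_⟩
  have hNlarge : ∀ᶠ n : ℕ in Filter.atTop, ∀ j, α j ^ n / 2 ≤ N n j := by
    refine Filter.eventually_all.2 fun j => ?_
    filter_upwards [(hN j).eventually_const_lt (by norm_num : (1 / 2 : ℝ) < 1)] with n hn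
    have : 0 < α j ^ n := pow_pos (by linarith [hα j]) n
    rw [lt_div_iff₀ this] at hn
    linarith
  filter_upwards [hNlarge] with n hn
  have hNpos : ∀ j, 0 < N n j := fun j => by
    have : 0 < α j ^ n := pow_pos (by linarith [hα j]) n
    exact_mod_cast (half_pos this).trans_le (hn j)
  have hzero := edgeLaw_exists_zero_le (N := N n) hp hp2 hNpos
    (fun j => Real.sqrt n * Real.sqrt (a j)) (c := c) (r := R / 2)
    (B := 48 * (d * 2 ^ d * Real.exp (-κ * n))) (by linarith) fun β hβ => by
      refine (integral_norm_normalizedPartition_sub_one_rpow_le hp hp2 hNpos _ β).2.trans ?_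
      refine mul_le_mul_of_nonneg_left ?_ (by norm_num)
      refine sum_prod_Iic_le (fun j => mul_nonneg (by positivity) (weightMoment_pos _ _ _).le)
        (Real.exp_pos _).le (Real.exp_le_one_iff.2 ?_) fun j => ?_
      · have : 0 ≤ κ * n := by positivity
        linarith
      · refine rpow_mul_weightMoment_le hp hp2 (ha j) (hα j) (hn j) (δ := s ^ 2 - b) ?_ (hκle j)
        have h1 : p * β.re ^ 2 + p / (p - 1) * β.im ^ 2 < b :=
          hball (by rwa [mul_div_cancel₀ _ two_ne_zero] at hβ)
        have h2 : s ^ 2 ≤ criticalTemp (a j) (α j) ^ 2 := by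
          gcongr
          exact hsσ j
        linarith
  refine (measure_mono ?_).trans (hzero.trans (ENNReal.ofReal_le_ofReal ?_))
  · rintro x ⟨β, hβ, h0⟩
    exact ⟨β, hβ, normalizedPartition_eq_zero h0⟩
  · have := Real.exp_pos (-κ * n)
    linarith

/-- Independence identifies the joint law with the product law. Passing to a measurable hull gives
the inequality for arbitrary `S`. -/
theorem measure_comp_le_edgeLaw {N : Fin d → ℕ} {Ω : Type*} [MeasurableSpace Ω] {μ : Measure Ω}
    [IsProbabilityMeasure μ] {ξ : Edge N → Ω → ℝ} (hξ : ∀ e, HasLaw (ξ e) (gaussianReal 0 1) μ)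
    (hi : iIndepFun ξ μ) (S : Set (Edge N → ℝ)) :
    μ {ω | (fun e => ξ e ω) ∈ S} ≤ edgeLaw N S := by
  have hae : ∀ e, AEMeasurable (ξ e) μ := fun e => (hξ e).aemeasurable
  have hmap : μ.map (fun ω e => ξ e ω) = edgeLaw N := by
    rw [(iIndepFun_iff_map_fun_eq_pi_map hae).1 hi, edgeLaw]
    congr 1
    ext1 e
    exact (hξ e).map_eq
  rw [← measure_toMeasurable S, ← hmap, Measure.map_apply_of_aemeasurable
    (aemeasurable_pi_lambda _ hae) (measurableSet_toMeasurable _ _)]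
  exact measure_mono fun ω hω => subset_toMeasurable _ _ hω

end GREM

theorem theorem2p14 (d : ℕ) (hd : 0 < d) (a α : Fin d → ℝ)
    (ha : ∀ j, 0 < a j) (hα : ∀ j, 1 < α j)
    (hσ : StrictMono fun j : Fin d => GREM.criticalTemp (a j) (α j))
    (N : ℕ → Fin d → ℕ)
    (hN : ∀ j, Filter.Tendsto (fun n : ℕ => (N n j : ℝ) / α j ^ n) Filter.atTop (nhds 1))
    (K : Set ℂ) (hK : IsCompact K)
    (hKE : K ⊆ GREM.phaseE (GREM.criticalTemp (a ⟨0, hd⟩) (α ⟨0, hd⟩))) :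
    ∃ C > (0 : ℝ), ∃ ε > (0 : ℝ), ∀ n : ℕ,
      ∀ (Ω : Type*) [MeasurableSpace Ω] (μ : MeasureTheory.Measure Ω)
        [MeasureTheory.IsProbabilityMeasure μ] (ξ : GREM.Edge (N n) → Ω → ℝ),
        (∀ e, ProbabilityTheory.HasLaw (ξ e) (ProbabilityTheory.gaussianReal 0 1) μ) →
        ProbabilityTheory.iIndepFun ξ μ →
        μ.real {ω | ∃ β ∈ K, GREM.partitionFunction a n (fun e => ξ e ω) β = 0}
          < C * Real.exp (-ε * n) := by
  have hsmall : GREM.ExpSmallZeros a N K := by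
    refine hK.induction_on (p := GREM.ExpSmallZeros a N) ?_
      (fun S T h hT => hT.mono h) (fun S T hS hT => hS.union hT) fun c hc => ?_
    · exact ⟨1, one_pos, 1, one_pos, fun n => by simp⟩
    · obtain ⟨U, hU, hUs⟩ := GREM.exists_nhds_expSmallZeros ha hα hN
        (GREM.criticalTemp_pos (ha ⟨0, hd⟩) (hα ⟨0, hd⟩))
        (fun j => hσ.monotone (Nat.zero_le j : (⟨0, hd⟩ : Fin d) ≤ j)) (hKE hc)
      exact ⟨U, mem_nhdsWithin_of_mem_nhds hU, hUs⟩
  obtain ⟨C, hC, ε, hε, H⟩ := hsmall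
  -- Enlarging the constant makes the inequality strict.
  refine ⟨C + 1, by linarith, ε, hε, fun n Ω _ μ _ ξ hξ hi => ?_⟩
  have h := ENNReal.toReal_le_of_le_ofReal (by positivity)
    ((GREM.measure_comp_le_edgeLaw hξ hi
      {x | ∃ β ∈ K, GREM.partitionFunction a n x β = 0}).trans (H n))
  refine lt_of_le_of_lt h ?_
  gcongr
  linarith
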